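/- Let $\mathcal{M}$ be a countable non-standard model of true arithmetic, i.e. a countable structure in the language $\{0,1,+,\cdot,<\}$ that satisfies every first-order sentence true in the standard model $\mathbb{N}$ and is not isomorphic to $\mathbb{N}$. Then $SR(\mathcal{M})>\omega$. Here the (parameterless) Scott rank $SR(\mathcal{A})$ of a countable structure $\mathcal{A}$ is the least ordinal $\alpha<\omega_1$ such that the automorphism orbit of every finite tuple of $\mathcal{A}$ is definable in $\mathcal{A}$ by a $\Sigma^{\mathrm{in}}_\alpha$ formula without parameters. The classes of $L_{\omega_1\omega}$ formulas used are as follows: the $\Sigma^{\mathrm{in}}_0$ and the $\Pi^{\mathrm{in}}_0$ formulas are the finitary quantifier-free formulas; for $\alpha>0$, a $\Sigma^{\mathrm{in}}_\alpha$ formula is a countable disjunction of formulas $\exists\bar y\,\psi$, where each $\psi$ is $\Pi^{\mathrm{in}}_\beta$ for some $\beta<\alpha$, and a $\Pi^{\mathrm{in}}_\alpha$ formula is a countable conjunction of formulas $\forall\bar y\,\psi$, where each $\psi$ is $\Sigma^{\mathrm{in}}_\beta$ for some $\beta<\alpha$. -/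

import Mathlib

open FirstOrder

/-! ### The language of arithmetic and its standard model -/

/-- Function symbols of arithmetic: `0`, `1`, `+`, `·`. -/
inductive ArithFunc : ℕ → Type
  | zero : ArithFunc 0
  | one : ArithFunc 0
  | add : ArithFunc 2
  | mul : ArithFunc 2

/-- Relation symbols of arithmetic: `<`. -/
inductive ArithRel : ℕ → Type
  | lt : ArithRel 2

/-- The language `{0, 1, +, ·, <}` of ordered semirings. -/
def arith : FirstOrder.Language where
  Functions := ArithFunc
  Relations := ArithRel

/-- The standard model of arithmetic. -/
instance arithStructureNat : arith.Structure ℕ where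
  funMap {_} f := match f with
    | .zero => fun _ => 0
    | .one => fun _ => 1
    | .add => fun v => v 0 + v 1
    | .mul => fun v => v 0 * v 1
  RelMap {_} r := match r with
    | .lt => fun v => v 0 < v 1

/-- True arithmetic: all first-order sentences of the language of arithmetic true in `ℕ`. -/
def trueArithmetic : arith.Theory := arith.completeTheory ℕ

/-- A structure for the language of arithmetic is non-standard if it is not isomorphic to `ℕ`. -/
def IsNonstandard (M : Type*) [arith.Structure M] : Prop := IsEmpty (M ≃[arith] ℕ)

/-! ### Formulas of `L_{ω₁ω}` and the classes `Σ^in_α`, `Π^in_α` -/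

/-- Formulas of the infinitary logic `L_{ω₁ω}` (in negation normal form, over finitary
quantifier-free formulas) with free variables indexed by `Fin n`. -/
inductive InfFormula (L : FirstOrder.Language.{0, 0}) : ℕ → Type
  /-- A finitary quantifier-free formula. -/
  | qf {n : ℕ} (φ : L.Formula (Fin n)) (hφ : FirstOrder.Language.BoundedFormula.IsQF φ) : InfFormula L n
  /-- The countable disjunction `⋁ᵢ fᵢ`. -/
  | disj {n : ℕ} (f : ℕ → InfFormula L n) : InfFormula L n
  /-- The countable conjunction `⋀ᵢ fᵢ`. -/
  | conj {n : ℕ} (f : ℕ → InfFormula L n) : InfFormula L n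
  /-- `∃ y₁ … y_k, φ`, where the last `k` free variables of `φ` are the quantified ones. -/
  | exs {n : ℕ} (k : ℕ) (φ : InfFormula L (n + k)) : InfFormula L n
  /-- `∀ y₁ … y_k, φ`, where the last `k` free variables of `φ` are the quantified ones. -/
  | alls {n : ℕ} (k : ℕ) (φ : InfFormula L (n + k)) : InfFormula L n

/-- Satisfaction of an `L_{ω₁ω}` formula by a tuple of a structure. -/
def InfFormula.Realize {L : FirstOrder.Language.{0, 0}} {M : Type*} [L.Structure M] :
    {n : ℕ} → InfFormula L n → (Fin n → M) → Prop
  | _, .qf φ _, a => φ.Realize a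
  | _, .disj f, a => ∃ i, (f i).Realize a
  | _, .conj f, a => ∀ i, (f i).Realize a
  | _, .exs k φ, a => ∃ b : Fin k → M, φ.Realize (Fin.append a b)
  | _, .alls k φ, a => ∀ b : Fin k → M, φ.Realize (Fin.append a b)

mutual

/-- `Σ^in_0` formulas are the finitary quantifier-free ones. For `α > 0`, a `Σ^in_α` formula is a
countable disjunction `⋁ᵢ ∃ȳᵢ ψᵢ` where each `ψᵢ` is `Π^in_β` for some `β < α`. -/
inductive InfFormula.IsSigma {L : FirstOrder.Language.{0, 0}} :
    {n : ℕ} → Ordinal.{0} → InfFormula L n → Prop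
  | qf {n : ℕ} (φ : L.Formula (Fin n)) (hφ : FirstOrder.Language.BoundedFormula.IsQF φ) :
      InfFormula.IsSigma 0 (InfFormula.qf φ hφ)
  | disj {n : ℕ} (α : Ordinal.{0}) (k : ℕ → ℕ) (ψ : (i : ℕ) → InfFormula L (n + k i))
      (β : ℕ → Ordinal.{0}) (hβ : ∀ i, β i < α) (hψ : ∀ i, InfFormula.IsPi (β i) (ψ i)) :
      InfFormula.IsSigma α (InfFormula.disj fun i => InfFormula.exs (k i) (ψ i))

/-- `Π^in_0` formulas are the finitary quantifier-free ones. For `α > 0`, a `Π^in_α` formula is a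
countable conjunction `⋀ᵢ ∀ȳᵢ ψᵢ` where each `ψᵢ` is `Σ^in_β` for some `β < α`. -/
inductive InfFormula.IsPi {L : FirstOrder.Language.{0, 0}} :
    {n : ℕ} → Ordinal.{0} → InfFormula L n → Prop
  | qf {n : ℕ} (φ : L.Formula (Fin n)) (hφ : FirstOrder.Language.BoundedFormula.IsQF φ) :
      InfFormula.IsPi 0 (InfFormula.qf φ hφ)
  | conj {n : ℕ} (α : Ordinal.{0}) (k : ℕ → ℕ) (ψ : (i : ℕ) → InfFormula L (n + k i))
      (β : ℕ → Ordinal.{0}) (hβ : ∀ i, β i < α) (hψ : ∀ i, InfFormula.IsSigma (β i) (ψ i)) :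
      InfFormula.IsPi α (InfFormula.conj fun i => InfFormula.alls (k i) (ψ i))

end

/-! ### Automorphism orbits and Scott rank -/

/-- The automorphism orbit of a tuple. -/
def autOrbit (L : FirstOrder.Language.{0, 0}) {M : Type*} [L.Structure M] {n : ℕ} (a : Fin n → M) :
    Set (Fin n → M) :=
  {b | ∃ σ : M ≃[L] M, ∀ i, σ (a i) = b i}

/-- Every automorphism orbit of a tuple is defined by a `Σ^in_α` formula without parameters. -/
def OrbitsSigmaDefinable (L : FirstOrder.Language.{0, 0}) (M : Type*) [L.Structure M]
    (α : Ordinal.{0}) : Prop :=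
  ∀ (n : ℕ) (a : Fin n → M), ∃ φ : InfFormula L n,
    φ.IsSigma α ∧ ∀ b : Fin n → M, φ.Realize b ↔ b ∈ autOrbit L a

/-- The (parameterless) Scott rank: the least `α < ω₁` such that every automorphism orbit is
`Σ^in_α`-definable without parameters. Meant for countable structures, for which such an `α`
exists; the value is `0` if there is none. -/
noncomputable def scottRank (L : FirstOrder.Language.{0, 0}) (M : Type*) [L.Structure M] : Ordinal.{0} :=
  sInf {α : Ordinal.{0} | α < Ordinal.omega 1 ∧ OrbitsSigmaDefinable L M α}

namespace ScottArith

open FirstOrder.Language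

/-! ### Isomorphism invariance of infinitary formulas -/

-- If a formula of level at most `ω` holds at `a`, it is implied by a formula of finite level that
-- holds at `a`, essentially one disjunct. So it suffices, for a nonstandard `a` and each finite
-- `n`, to find `b` outside the orbit of `a` that satisfies the same formulas of level at most `n`.
--
-- With finite sequences coded by Gödel's beta function, the `n`-th back-and-forth relation,
-- truncated to positions below `k`, is first-order (`dfn_backForth`). In `ℕ`, for fixed `k`, there
-- are finitely many types, all realised below some bound. By transfer, every standard `k` admits
-- some `b < a` equivalent to `a`, and overspill gives a nonstandard such `k`
-- (`exists_smaller_of_nonstandard`). All standard positions then lie below `k`, so the coded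
-- relation forces agreement on infinitary formulas of finite level (`realize_iff_of_backForth`).
--
-- To keep `b` out of the orbit, it is chosen definably: the largest `k < a` that works, then the
-- least `b`. This partial map is descending, so the parity of the length of its iteration is a
-- definable colour on which `a` and `b` differ (`coloured_of_smaller`).
--
-- Since the rank is an infimum, equal to `0` on the empty set, Scott's theorem
-- (`exists_orbitsSigmaDefinable`) is needed as well.

theorem comp_finAppend {α β : Type*} (f : α → β) {m n : ℕ} (a : Fin m → α) (b : Fin n → α) :
    f ∘ Fin.append a b = Fin.append (f ∘ a) (f ∘ b) := by
  funext i
  refine Fin.addCases (fun i => ?_) (fun i => ?_) i <;> simp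

theorem realize_comp_equiv {L : FirstOrder.Language.{0, 0}} {M N : Type*} [L.Structure M]
    [L.Structure N] (e : M ≃[L] N) {n : ℕ} (φ : InfFormula L n) (a : Fin n → M) :
    φ.Realize (e ∘ a) ↔ φ.Realize a := by
  have hsymm : ∀ {k : ℕ} (b : Fin k → N), e ∘ e.symm ∘ b = b := fun b => by
    funext i; simp
  induction φ with
  | qf φ hφ => exact StrongHomClass.realize_formula e φ
  | disj f ih => simp only [InfFormula.Realize, ih]
  | conj f ih => simp only [InfFormula.Realize, ih]
  | exs k φ ih =>
    simp only [InfFormula.Realize]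
    constructor
    · rintro ⟨b, hb⟩
      exact ⟨e.symm ∘ b, (ih _).1 (by rwa [comp_finAppend, hsymm])⟩
    · rintro ⟨b, hb⟩
      exact ⟨e ∘ b, by rw [← comp_finAppend]; exact (ih _).2 hb⟩
  | alls k φ ih =>
    simp only [InfFormula.Realize]
    constructor
    · intro h b
      have := h (e ∘ b)
      rw [← comp_finAppend] at this
      exact (ih _).1 this
    · intro h b
      rw [← hsymm b, ← comp_finAppend]
      exact (ih _).2 (h _)

/-! ### Uniformly definable relations -/

section Generic

variable {N : Type*} [arith.Structure N]

/-- The interpretation of `0`. -/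
def zeroA : N := Structure.funMap (L := arith) ArithFunc.zero ![]

/-- The interpretation of `1`. -/
def oneA : N := Structure.funMap (L := arith) ArithFunc.one ![]

/-- The interpretation of `+`. -/
def addA (a b : N) : N := Structure.funMap (L := arith) ArithFunc.add ![a, b]

/-- The interpretation of `·`. -/
def mulA (a b : N) : N := Structure.funMap (L := arith) ArithFunc.mul ![a, b]

/-- The interpretation of `<`. -/
def ltA (a b : N) : Prop := Structure.RelMap (L := arith) ArithRel.lt ![a, b]

end Generic

@[simp] theorem zeroA_nat : (zeroA : ℕ) = 0 := rfl
@[simp] theorem oneA_nat : (oneA : ℕ) = 1 := rfl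
@[simp] theorem addA_nat (a b : ℕ) : addA a b = a + b := rfl
@[simp] theorem mulA_nat (a b : ℕ) : mulA a b = a * b := rfl
@[simp] theorem ltA_nat (a b : ℕ) : ltA a b ↔ a < b := Iff.rfl

/-- A relation, given in every structure, is definable if one formula defines it everywhere. -/
def Dfn {n : ℕ} (P : ∀ (N : Type) [arith.Structure N], (Fin n → N) → Prop) : Prop :=
  ∃ φ : arith.Formula (Fin n), ∀ (N : Type) [arith.Structure N] (v : Fin n → N),
    φ.Realize v ↔ P N v

/-- An operation, given in every structure, is definable if one term defines it everywhere. -/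
def DfnT {n : ℕ} (t : ∀ (N : Type) [arith.Structure N], (Fin n → N) → N) : Prop :=
  ∃ τ : arith.Term (Fin n), ∀ (N : Type) [arith.Structure N] (v : Fin n → N),
    τ.realize v = t N v

-- Closure properties of uniform definability.

section closure

variable {n : ℕ} {s t : ∀ (N : Type) [arith.Structure N], (Fin n → N) → N}
  {P Q : ∀ (N : Type) [arith.Structure N], (Fin n → N) → Prop}

theorem DfnT.var (i : Fin n) : DfnT fun (N : Type) [arith.Structure N] v => v i :=
  ⟨Term.var i, fun _ _ _ => rfl⟩

theorem DfnT.zero : DfnT fun (N : Type) [arith.Structure N] (_ : Fin n → N) => (zeroA : N) :=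
  ⟨Term.func (L := arith) ArithFunc.zero ![], fun N _ v => by
    exact congrArg (Structure.funMap (L := arith) ArithFunc.zero) (funext fun i => i.elim0)⟩

theorem DfnT.one : DfnT fun (N : Type) [arith.Structure N] (_ : Fin n → N) => (oneA : N) :=
  ⟨Term.func (L := arith) ArithFunc.one ![], fun N _ v => by
    exact congrArg (Structure.funMap (L := arith) ArithFunc.one) (funext fun i => i.elim0)⟩

theorem DfnT.add (hs : DfnT s) (ht : DfnT t) :
    DfnT fun (N : Type) [arith.Structure N] v => addA (s N v) (t N v) := by
  obtain ⟨σ, hσ⟩ := hs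
  obtain ⟨τ, hτ⟩ := ht
  refine ⟨Term.func (L := arith) ArithFunc.add ![σ, τ], fun N _ v => ?_⟩
  simp only [← hσ, ← hτ]
  refine congrArg (Structure.funMap (L := arith) ArithFunc.add) (funext fun i => ?_)
  fin_cases i <;> rfl

theorem DfnT.mul (hs : DfnT s) (ht : DfnT t) :
    DfnT fun (N : Type) [arith.Structure N] v => mulA (s N v) (t N v) := by
  obtain ⟨σ, hσ⟩ := hs
  obtain ⟨τ, hτ⟩ := ht
  refine ⟨Term.func (L := arith) ArithFunc.mul ![σ, τ], fun N _ v => ?_⟩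
  simp only [← hσ, ← hτ]
  refine congrArg (Structure.funMap (L := arith) ArithFunc.mul) (funext fun i => ?_)
  fin_cases i <;> rfl

theorem Dfn.lt (hs : DfnT s) (ht : DfnT t) :
    Dfn fun (N : Type) [arith.Structure N] v => ltA (s N v) (t N v) := by
  obtain ⟨σ, hσ⟩ := hs
  obtain ⟨τ, hτ⟩ := ht
  refine ⟨Relations.formula (L := arith) ArithRel.lt ![σ, τ], fun N _ v => ?_⟩
  simp only [← hσ, ← hτ]
  refine Formula.realize_rel.trans (iff_of_eq ?_)
  refine congrArg (Structure.RelMap (L := arith) ArithRel.lt) (funext fun i => ?_)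
  fin_cases i <;> rfl

theorem Dfn.eq (hs : DfnT s) (ht : DfnT t) :
    Dfn fun (N : Type) [arith.Structure N] v => s N v = t N v := by
  obtain ⟨σ, hσ⟩ := hs
  obtain ⟨τ, hτ⟩ := ht
  exact ⟨σ.equal τ, fun N _ v => by rw [Formula.realize_equal, hσ, hτ]⟩

theorem Dfn.not (hP : Dfn P) : Dfn fun (N : Type) [arith.Structure N] v => ¬ P N v := by
  obtain ⟨φ, hφ⟩ := hP
  exact ⟨φ.not, fun N _ v => by rw [Formula.realize_not, hφ]⟩

theorem Dfn.and (hP : Dfn P) (hQ : Dfn Q) :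
    Dfn fun (N : Type) [arith.Structure N] v => P N v ∧ Q N v := by
  obtain ⟨φ, hφ⟩ := hP
  obtain ⟨ψ, hψ⟩ := hQ
  exact ⟨φ ⊓ ψ, fun N _ v => by rw [Formula.realize_inf, hφ, hψ]⟩

theorem Dfn.or (hP : Dfn P) (hQ : Dfn Q) :
    Dfn fun (N : Type) [arith.Structure N] v => P N v ∨ Q N v := by
  obtain ⟨φ, hφ⟩ := hP
  obtain ⟨ψ, hψ⟩ := hQ
  exact ⟨φ ⊔ ψ, fun N _ v => by rw [Formula.realize_sup, hφ, hψ]⟩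

theorem Dfn.imp (hP : Dfn P) (hQ : Dfn Q) :
    Dfn fun (N : Type) [arith.Structure N] v => P N v → Q N v := by
  obtain ⟨φ, hφ⟩ := hP
  obtain ⟨ψ, hψ⟩ := hQ
  exact ⟨φ.imp ψ, fun N _ v => by rw [Formula.realize_imp, hφ, hψ]⟩

theorem Dfn.iff (hP : Dfn P) (hQ : Dfn Q) :
    Dfn fun (N : Type) [arith.Structure N] v => (P N v ↔ Q N v) := by
  obtain ⟨φ, hφ⟩ := hP
  obtain ⟨ψ, hψ⟩ := hQ
  exact ⟨φ.iff ψ, fun N _ v => by rw [Formula.realize_iff, hφ, hψ]⟩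

theorem Dfn.relabel (hP : Dfn P) {m : ℕ} (f : Fin n → Fin m) :
    Dfn fun (N : Type) [arith.Structure N] v => P N (fun i => v (f i)) := by
  obtain ⟨φ, hφ⟩ := hP
  exact ⟨φ.relabel f, fun N _ v => by rw [Formula.realize_relabel, hφ]; rfl⟩

theorem Dfn.all {P : ∀ (N : Type) [arith.Structure N], (Fin n → N) → N → Prop}
    (hP : Dfn fun (N : Type) [arith.Structure N] (w : Fin (n + 1) → N) =>
      P N (fun i => w i.castSucc) (w (Fin.last n))) :
    Dfn fun (N : Type) [arith.Structure N] v => ∀ b, P N v b := by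
  obtain ⟨φ, hφ⟩ := hP
  -- The last free variable becomes the bound one; the others stay free.
  refine ⟨BoundedFormula.all (n := 0)
    (BoundedFormula.relabel (k := 0)
      (Fin.lastCases (Sum.inr 0) Sum.inl : Fin (n + 1) → Fin n ⊕ Fin 1) φ),
    fun N _ v => ?_⟩
  refine forall_congr' fun b => ?_
  refine BoundedFormula.realize_relabel.trans ?_
  have h := hφ N (Fin.snoc v b)
  simp only [Fin.snoc_castSucc, Fin.snoc_last] at h
  rw [← h]
  refine iff_of_eq ?_
  unfold Formula.Realize
  congr 1
  · funext i
    refine Fin.lastCases ?_ (fun j => ?_) i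
    · simpa using Fin.snoc_last (n := 0) (α := fun _ => N) b default
    · simp
  · exact Subsingleton.elim _ _

theorem Dfn.ex {P : ∀ (N : Type) [arith.Structure N], (Fin n → N) → N → Prop}
    (hP : Dfn fun (N : Type) [arith.Structure N] (w : Fin (n + 1) → N) =>
      P N (fun i => w i.castSucc) (w (Fin.last n))) :
    Dfn fun (N : Type) [arith.Structure N] v => ∃ b, P N v b := by
  have h := (Dfn.all (P := fun N _ v b => ¬ P N v b) hP.not).not
  simpa using h

end closure

/-! ### Transfer between the standard model and models of true arithmetic -/

/-- The numerals of a structure. -/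
def num (N : Type*) [arith.Structure N] : ℕ → N
  | 0 => zeroA
  | n + 1 => addA (num N n) oneA

theorem num_nat (n : ℕ) : num ℕ n = n := by
  induction n with
  | zero => rfl
  | succ n ih => simp [num, ih]

/-- The closed term denoting a numeral. -/
def numTerm : ℕ → arith.Term Empty
  | 0 => Term.func (L := arith) ArithFunc.zero ![]
  | n + 1 => Term.func (L := arith) ArithFunc.add
      ![numTerm n, Term.func (L := arith) ArithFunc.one ![] ]

theorem realize_numTerm {N : Type*} [arith.Structure N] (n : ℕ) (v : Empty → N) :
    (numTerm n).realize v = num N n := by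
  induction n with
  | zero => exact congrArg (Structure.funMap (L := arith) ArithFunc.zero) (funext fun i => i.elim0)
  | succ n ih =>
    refine congrArg (Structure.funMap (L := arith) ArithFunc.add) (funext fun i => ?_)
    fin_cases i
    · exact ih
    · exact congrArg (Structure.funMap (L := arith) ArithFunc.one) (funext fun i => i.elim0)

section Transfer

variable {M : Type} [arith.Structure M]

theorem realize_iff_of_model (hTA : M ⊨ trueArithmetic) (φ : arith.Sentence) : M ⊨ φ ↔ ℕ ⊨ φ := by
  refine ⟨fun h => ?_, fun h => hTA.realize_of_mem φ h⟩
  by_contra hn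
  have : φ.not ∈ trueArithmetic := by
    show ℕ ⊨ φ.not
    rwa [Sentence.realize_not]
  exact (Sentence.realize_not M).1 (hTA.realize_of_mem _ this) h

variable {n : ℕ} {P : ∀ (N : Type) [arith.Structure N], (Fin n → N) → Prop}

/-- Substituting closed numeral terms for the variables yields a sentence, whose truth is the same
in `M` and `ℕ`. -/
theorem Dfn.num_iff (hP : Dfn P) (hTA : M ⊨ trueArithmetic) (v : Fin n → ℕ) :
    P M (fun i => num M (v i)) ↔ P ℕ v := by
  obtain ⟨φ, hφ⟩ := hP
  rw [← hφ, ← hφ]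
  have h := realize_iff_of_model hTA (BoundedFormula.subst φ fun i => numTerm (v i))
  simp only [Sentence.Realize, Formula.Realize, BoundedFormula.realize_subst, realize_numTerm,
    num_nat] at h
  exact h

/-- The universal closure of the defining formula is a sentence true in `ℕ`. -/
theorem Dfn.transfer (hP : Dfn P) (hTA : M ⊨ trueArithmetic) (h : ∀ v, P ℕ v) (v : Fin n → M) :
    P M v := by
  obtain ⟨φ, hφ⟩ := hP
  have key : ∀ (N : Type) [arith.Structure N] (w : Fin n → N),
      (BoundedFormula.relabel (k := 0) (Sum.inr : Fin n → Empty ⊕ Fin n) φ).Realize default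
        (w ∘ Fin.cast (add_zero n)) ↔ P N w := fun N _ w => by
    refine BoundedFormula.realize_relabel.trans ((iff_of_eq ?_).trans (hφ N w))
    exact congrArg₂ _ rfl (Subsingleton.elim _ _)
  exact (key M v).1 ((BoundedFormula.realize_alls.1 ((realize_iff_of_model hTA _).2
    (BoundedFormula.realize_alls.2 fun xs => (key ℕ xs).2 (h xs)))) v)

theorem Dfn.equiv_iff (hP : Dfn P) (σ : M ≃[arith] M) (v : Fin n → M) :
    P M (fun i => σ (v i)) ↔ P M v := by
  obtain ⟨φ, hφ⟩ := hP
  rw [← hφ, ← hφ]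
  exact StrongHomClass.realize_formula σ φ

end Transfer

/-! ### Coding of sequences -/

section Generic

variable {N : Type*} [arith.Structure N]

/-- The `i`-th entry of the sequence coded by `x` is `v`, for Gödel's coding `Nat.beta`. -/
def Entry (x i v : N) : Prop :=
  ∃ c d, ((ltA c d ∧ x = addA (mulA d d) c) ∨ (¬ ltA c d ∧ x = addA (addA (mulA c c) c) d)) ∧
    ltA v (addA (mulA (addA i oneA) d) oneA) ∧
    ∃ q, c = addA (mulA q (addA (mulA (addA i oneA) d) oneA)) v

/-- The sequences coded by `x` and `y` have the same entries below `l`. -/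
def Agree (l x y : N) : Prop :=
  ∀ i, ltA i l → ∀ v, Entry x i v ↔ Entry y i v

/-- The pairs `p, p'`, `q, q'`, `r, r'` satisfy the same unnested atomic formulas. -/
def SameAtomic (p q r p' q' r' : N) : Prop :=
  (ltA p q ↔ ltA p' q') ∧ (p = q ↔ p' = q') ∧ (addA p q = r ↔ addA p' q' = r') ∧
    (mulA p q = r ↔ mulA p' q' = r') ∧ (p = zeroA ↔ p' = zeroA) ∧ (p = oneA ↔ p' = oneA)

/-- The `n`-th back-and-forth relation between coded sequences, truncated at `k`. -/
def BackForth (k : N) : ℕ → N → N → Prop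
  | 0, x, y => ∀ i j m, ltA i k → ltA j k → ltA m k → ∀ p q r p' q' r',
      Entry x i p → Entry x j q → Entry x m r → Entry y i p' → Entry y j q' → Entry y m r' →
      SameAtomic p q r p' q' r'
  | n + 1, x, y => ∀ l, ltA l k →
      (∀ x', Agree l x x' → ∃ y', Agree l y y' ∧ BackForth k n x' y') ∧
      (∀ y', Agree l y y' → ∃ x', Agree l x x' ∧ BackForth k n x' y')

/-- The truncated back-and-forth relation between single elements. -/
def BackForthElem (n : ℕ) (k a b : N) : Prop :=
  ∃ x y, Entry x zeroA a ∧ Entry y zeroA b ∧ BackForth k n x y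

/-- `y` is the least element equivalent to `x` at the largest truncation `k < x` at which some
element below `x` is equivalent to `x`. -/
def Smaller (n : ℕ) (x y : N) : Prop :=
  ∃ k, ltA k x ∧ ltA y x ∧ BackForthElem n k x y ∧ (∀ z, ltA z y → ¬ BackForthElem n k x z) ∧
    ∀ k', ltA k' x → ltA k k' → ∀ z, ltA z x → ¬ BackForthElem n k' x z

/-- A colour such that `x` and `y` have different colours whenever `Smaller n x y`. -/
def Coloured (n : ℕ) (x : N) : Prop :=
  ∃ s, Entry s x oneA ∧ ∀ i, (ltA i x ∨ i = x) →
    (Entry s i oneA ↔ ∃ j, Smaller n i j ∧ ¬ Entry s j oneA)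

end Generic

-- First-order definability of the coded relations.

section definability

variable {m : ℕ}

theorem dfn_entry (x i v : Fin m) :
    Dfn fun (N : Type) [arith.Structure N] w => Entry (w x) (w i) (w v) := by
  unfold Entry
  repeat' first
    | exact DfnT.var _
    | exact DfnT.one
    | apply Dfn.ex
    | apply Dfn.and
    | apply Dfn.or
    | apply Dfn.not
    | apply Dfn.lt
    | apply Dfn.eq
    | apply DfnT.add
    | apply DfnT.mul

theorem dfn_agree (l x y : Fin m) :
    Dfn fun (N : Type) [arith.Structure N] w => Agree (w l) (w x) (w y) := by
  unfold Agree
  repeat' first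
    | exact DfnT.var _
    | exact dfn_entry _ _ _
    | apply Dfn.all
    | apply Dfn.lt
    | apply Dfn.iff
    | apply Dfn.imp

theorem dfn_sameAtomic (p q r p' q' r' : Fin m) :
    Dfn fun (N : Type) [arith.Structure N] w =>
      SameAtomic (w p) (w q) (w r) (w p') (w q') (w r') := by
  unfold SameAtomic
  repeat' first
    | exact DfnT.var _
    | exact DfnT.zero
    | exact DfnT.one
    | apply Dfn.and
    | apply Dfn.iff
    | apply Dfn.lt
    | apply Dfn.eq
    | apply DfnT.add
    | apply DfnT.mul

/-- The level `n` is external, so each level gets its own formula. The truncation `k` is an internal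
variable and may take nonstandard values. -/
theorem dfn_backForth (n : ℕ) {m : ℕ} (k x y : Fin m) :
    Dfn fun (N : Type) [arith.Structure N] w => BackForth (w k) n (w x) (w y) := by
  induction n generalizing m with
  | zero =>
    unfold BackForth
    repeat' first
      | exact DfnT.var _
      | exact dfn_entry _ _ _
      | exact dfn_sameAtomic _ _ _ _ _ _
      | apply Dfn.all
      | apply Dfn.lt
      | apply Dfn.imp
  | succ n ih =>
    unfold BackForth
    repeat' first
      | exact DfnT.var _
      | exact dfn_agree _ _ _
      | exact ih _ _ _
      | apply Dfn.all
      | apply Dfn.ex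
      | apply Dfn.and
      | apply Dfn.lt
      | apply Dfn.imp

theorem dfn_entry_zero (x v : Fin m) :
    Dfn fun (N : Type) [arith.Structure N] w => Entry (w x) zeroA (w v) := by
  have : Dfn fun (N : Type) [arith.Structure N] w =>
      ∃ z : N, z = zeroA ∧ Entry (w x) z (w v) := by
    repeat' first
      | exact DfnT.var _
      | exact DfnT.zero
      | exact dfn_entry _ _ _
      | apply Dfn.ex
      | apply Dfn.and
      | apply Dfn.eq
  simpa using this

theorem dfn_entry_one (x i : Fin m) :
    Dfn fun (N : Type) [arith.Structure N] w => Entry (w x) (w i) oneA := by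
  have : Dfn fun (N : Type) [arith.Structure N] w =>
      ∃ z : N, z = oneA ∧ Entry (w x) (w i) z := by
    repeat' first
      | exact DfnT.var _
      | exact DfnT.one
      | exact dfn_entry _ _ _
      | apply Dfn.ex
      | apply Dfn.and
      | apply Dfn.eq
  simpa using this

theorem dfn_backForthElem (n : ℕ) (k a b : Fin m) :
    Dfn fun (N : Type) [arith.Structure N] w => BackForthElem n (w k) (w a) (w b) := by
  unfold BackForthElem
  repeat' first
    | exact dfn_entry_zero _ _
    | exact dfn_backForth _ _ _ _
    | apply Dfn.ex
    | apply Dfn.and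

theorem dfn_smaller (n : ℕ) (x y : Fin m) :
    Dfn fun (N : Type) [arith.Structure N] w => Smaller n (w x) (w y) := by
  unfold Smaller
  repeat' first
    | exact DfnT.var _
    | exact dfn_backForthElem _ _ _ _
    | apply Dfn.ex
    | apply Dfn.all
    | apply Dfn.and
    | apply Dfn.lt
    | apply Dfn.not
    | apply Dfn.imp

theorem dfn_coloured (n : ℕ) (x : Fin m) :
    Dfn fun (N : Type) [arith.Structure N] w => Coloured n (w x) := by
  unfold Coloured
  repeat' first
    | exact DfnT.var _
    | exact dfn_entry_one _ _
    | exact dfn_smaller _ _ _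
    | apply Dfn.ex
    | apply Dfn.all
    | apply Dfn.and
    | apply Dfn.or
    | apply Dfn.lt
    | apply Dfn.eq
    | apply Dfn.iff
    | apply Dfn.not
    | apply Dfn.imp

end definability

/-! ### The relations in the standard model -/

/-- The two cases in `Entry` are those of `Nat.pair`, and the bound on `v` makes it the remainder in
`Nat.beta`. -/
theorem entry_nat (x i v : ℕ) : Entry x i v ↔ Nat.beta x i = v := by
  simp only [Entry, ltA_nat, addA_nat, mulA_nat, oneA_nat, Nat.beta]
  constructor
  · rintro ⟨c, d, hx, hv, q, hq⟩
    have : x = Nat.pair c d := by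
      unfold Nat.pair; split_ifs <;> omega
    rw [this, Nat.unpair_pair, hq]
    simp only
    rw [Nat.mul_add_mod', Nat.mod_eq_of_lt hv]
  · rintro rfl
    refine ⟨x.unpair.1, x.unpair.2, ?_, Nat.mod_lt _ (Nat.succ_pos _), _,
      (Nat.div_add_mod' _ _).symm⟩
    have := Nat.pair_unpair x
    unfold Nat.pair at this
    split_ifs at this <;> omega

theorem exists_entries_nat (f : ℕ → ℕ) (l : ℕ) : ∃ x : ℕ, ∀ i < l, Nat.beta x i = f i := by
  refine ⟨Nat.unbeta (List.ofFn fun i : Fin l => f i), fun i hi => ?_⟩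
  have := Nat.beta_unbeta_coe (List.ofFn fun i : Fin l => f i) ⟨i, by simpa using hi⟩
  simpa using this

theorem agree_nat (l x y : ℕ) : Agree l x y ↔ ∀ i < l, Nat.beta x i = Nat.beta y i := by
  simp only [Agree, ltA_nat, entry_nat]
  exact forall₂_congr fun i _ => ⟨fun h => ((h _).2 rfl), fun h v => by rw [h]⟩

/-- Only positions below `k` matter. The level `0` type lists atomic facts about triples of
positions; the next type lists, for each `l < k`, the types of sequences agreeing below `l`. Both
range over finite sets. -/
theorem exists_finite_type_backForth (k n : ℕ) :
    ∃ (T : Type) (_ : Finite T) (τ : ℕ → T), ∀ x y, τ x = τ y → BackForth k n x y := by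
  induction n with
  | zero =>
    let e : ℕ → Fin k → ℕ := fun x i => Nat.beta x i
    refine ⟨(Fin k → Fin k → Fin k → Prop × Prop × Prop × Prop × Prop × Prop), inferInstance,
      fun x i j m => (e x i < e x j, e x i = e x j, e x i + e x j = e x m, e x i * e x j = e x m,
        e x i = 0, e x i = 1), fun x y h i j m hi hj hm p q r p' q' r' => ?_⟩
    have h := congrFun (congrFun (congrFun h ⟨i, hi⟩) ⟨j, hj⟩) ⟨m, hm⟩
    simp only [entry_nat]
    rintro rfl rfl rfl rfl rfl rfl
    simpa [e, SameAtomic] using h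
  | succ n ih =>
    obtain ⟨T, hT, τ, hτ⟩ := ih
    refine ⟨Fin k → Set T, inferInstance, fun x l => {t | ∃ x', Agree (l : ℕ) x x' ∧ τ x' = t},
      fun x y h l hl => ?_⟩
    have h := congrFun h ⟨l, hl⟩
    simp only [Set.ext_iff, Set.mem_ofPred_eq] at h
    constructor
    · intro x' hx'
      obtain ⟨y', hy', e⟩ := (h (τ x')).1 ⟨x', hx', rfl⟩
      exact ⟨y', hy', hτ _ _ e.symm⟩
    · intro y' hy'
      obtain ⟨x', hx', e⟩ := (h (τ y')).2 ⟨y', hy', rfl⟩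
      exact ⟨x', hx', hτ _ _ e⟩

theorem exists_bound_backForthElem (n k : ℕ) :
    ∃ B : ℕ, ∀ a : ℕ, ∃ b, ltA b B ∧ BackForthElem n k a b := by
  obtain ⟨T, hT, τ, hτ⟩ := exists_finite_type_backForth k n
  choose c hc using fun a : ℕ => exists_entries_nat (fun _ => a) 1
  have hfin : (Set.range fun a => τ (c a)).Finite := Set.toFinite _
  -- `c a` codes a sequence starting with `a`; `g` picks one element for each of the finitely many
  -- types.
  choose! g hg using fun t (ht : t ∈ Set.range fun a => τ (c a)) => ht
  obtain ⟨B, hB⟩ := (hfin.image g).bddAbove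
  refine ⟨B + 1, fun a => ⟨g (τ (c a)), ?_, c a, c (g (τ (c a))), ?_, ?_, hτ _ _ ?_⟩⟩
  · exact Nat.lt_succ_of_le (hB ⟨_, ⟨a, rfl⟩, rfl⟩)
  · exact (entry_nat _ _ _).2 (hc a 0 one_pos)
  · exact (entry_nat _ _ _).2 (hc _ 0 one_pos)
  · exact (hg _ ⟨a, rfl⟩).symm

theorem smaller_lt {n x y : ℕ} (h : Smaller n x y) : y < x := by
  obtain ⟨k, -, h, -⟩ := h
  exact h

theorem smaller_unique {n x y y' : ℕ} (h : Smaller n x y) (h' : Smaller n x y') : y = y' := by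
  obtain ⟨k, hk, hy, hR, hmin, hmax⟩ := h
  obtain ⟨k', hk', hy', hR', hmin', hmax'⟩ := h'
  have hkk : k = k' := by
    rcases lt_trichotomy k k' with h | h | h
    · exact absurd hR' (hmax k' hk' h y' hy')
    · exact h
    · exact absurd hR (hmax' k hk h y hy)
  subst hkk
  rcases lt_trichotomy y y' with h | h | h
  · exact absurd hR (hmin' y h)
  · exact h
  · exact absurd hR' (hmin y' h)

theorem exists_smaller {n x k z : ℕ} (hk : k < x) (hz : z < x) (h : BackForthElem n k x z) :
    ∃ y, Smaller n x y := by
  classical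
  -- Maximise the truncation first, then minimise the witness.
  let S := (Finset.range x).filter fun k => ∃ z < x, BackForthElem n k x z
  have hS : S.Nonempty := ⟨k, by simpa [S, hk] using ⟨z, hz, h⟩⟩
  have hmem := S.max'_mem hS
  set K := S.max' hS with hK
  simp only [S, Finset.mem_filter, Finset.mem_range] at hmem
  obtain ⟨hKx, hex⟩ := hmem
  obtain ⟨hlt, hR⟩ := Nat.find_spec hex
  refine ⟨Nat.find hex, K, hKx, hlt, hR, fun z hz hz' => Nat.find_min hex hz
    ⟨lt_trans hz hlt, hz'⟩, fun k' hk' hKk' z hz hz' => ?_⟩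
  have : k' ≤ K := S.le_max' k' (by simpa [S] using ⟨hk', z, hz, hz'⟩)
  exact absurd hKk' (not_lt.2 this)

/-- Well-founded recursion, since `Smaller` descends. The colour is the parity of the length of the
descent. -/
theorem exists_colouring (n : ℕ) :
    ∃ c : ℕ → Prop, ∀ i, c i ↔ ∃ j, Smaller n i j ∧ ¬ c j := by
  let F : (i : ℕ) → ((j : ℕ) → j < i → Prop) → Prop := fun i r =>
    ∃ j, ∃ h : Smaller n i j, ¬ r j (smaller_lt h)
  refine ⟨Nat.lt_wfRel.wf.fix F, fun i => ?_⟩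
  rw [WellFounded.fix_eq _ F i]
  simp only [F, exists_prop]

/-- A code `s` as in `Coloured` is forced by strong induction to record the recursive colouring up
to `x`. As `x` has at most one `Smaller` successor, the colour flips. -/
theorem coloured_of_smaller {n x y : ℕ} (h : Smaller n x y) : Coloured n x ↔ ¬ Coloured n y := by
  classical
  obtain ⟨c, hc⟩ := exists_colouring n
  have key : ∀ x, Coloured n x ↔ c x := by
    intro x
    constructor
    · rintro ⟨s, hs, hrec⟩
      have : ∀ i ≤ x, Entry s i (1 : ℕ) ↔ c i := by
        intro i
        induction i using Nat.strong_induction_on with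
        | _ i ih =>
          intro hi
          refine (hrec i (Nat.lt_or_eq_of_le hi)).trans ?_
          rw [hc]
          exact exists_congr fun j => and_congr_right fun hj =>
            not_congr (ih j (smaller_lt hj) ((smaller_lt hj).le.trans hi))
      exact (this x le_rfl).1 hs
    · intro hx
      obtain ⟨s, hs⟩ := exists_entries_nat (fun i => if c i then 1 else 0) (x + 1)
      have hE : ∀ i ≤ x, Entry s i (oneA : ℕ) ↔ c i := fun i hi => by
        rw [entry_nat, hs i (Nat.lt_succ_of_le hi)]
        by_cases h : c i <;> simp [h]
      refine ⟨s, (hE x le_rfl).2 hx, fun i hi => ?_⟩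
      have hi : i ≤ x := Nat.le_iff_lt_or_eq.2 hi
      rw [hE i hi, hc]
      exact exists_congr fun j => and_congr_right fun hj =>
        not_congr (hE j ((smaller_lt hj).le.trans hi)).symm
  rw [key, key, hc x]
  constructor
  · rintro ⟨j, hj, hj'⟩
    rwa [smaller_unique h hj]
  · exact fun hy => ⟨y, h, hy⟩

/-! ### Numerals and codes in models of true arithmetic -/

section Model

variable {M : Type} [arith.Structure M]

theorem num_injective (hTA : M ⊨ trueArithmetic) : Function.Injective (num M) := fun a b h =>
  (Dfn.num_iff (Dfn.eq (DfnT.var 0) (DfnT.var 1)) hTA ![a, b]).1 h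

theorem ltA_num (hTA : M ⊨ trueArithmetic) {a b : ℕ} : ltA (num M a) (num M b) ↔ a < b :=
  Dfn.num_iff (Dfn.lt (DfnT.var 0) (DfnT.var 1)) hTA ![a, b]

theorem num_one (hTA : M ⊨ trueArithmetic) : num M 1 = oneA :=
  Dfn.transfer (n := 0) (.eq (.add .zero .one) .one) hTA (fun _ => rfl) ![]

theorem addA_num (hTA : M ⊨ trueArithmetic) (a b : ℕ) :
    addA (num M a) (num M b) = num M (a + b) :=
  (Dfn.num_iff (Dfn.eq (DfnT.add (DfnT.var 0) (DfnT.var 1)) (DfnT.var 2)) hTA ![a, b, a + b]).2 rfl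

theorem mulA_num (hTA : M ⊨ trueArithmetic) (a b : ℕ) :
    mulA (num M a) (num M b) = num M (a * b) :=
  (Dfn.num_iff (Dfn.eq (DfnT.mul (DfnT.var 0) (DfnT.var 1)) (DfnT.var 2)) hTA ![a, b, a * b]).2 rfl

theorem ltA_trichotomy (hTA : M ⊨ trueArithmetic) (x y : M) : ltA x y ∨ x = y ∨ ltA y x :=
  Dfn.transfer (.or (.lt (.var 0) (.var 1)) (.or (.eq (.var 0) (.var 1)) (.lt (.var 1) (.var 0))))
    hTA (fun v => lt_trichotomy (v 0) (v 1)) ![x, y]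

theorem not_ltA_zero (hTA : M ⊨ trueArithmetic) (x : M) : ¬ ltA x zeroA :=
  Dfn.transfer (.not (.lt (.var 0) .zero)) hTA (fun v => Nat.not_lt_zero (v 0)) ![x]

theorem ltA_succ (hTA : M ⊨ trueArithmetic) (x y : M) : ltA x (addA y oneA) → ltA x y ∨ x = y :=
  Dfn.transfer (.imp (.lt (.var 0) (.add (.var 1) .one))
    (.or (.lt (.var 0) (.var 1)) (.eq (.var 0) (.var 1))))
    hTA (fun _ h => Nat.lt_succ_iff_lt_or_eq.1 h) ![x, y]

theorem ltA_trans (hTA : M ⊨ trueArithmetic) {x y z : M} : ltA x y → ltA y z → ltA x z :=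
  Dfn.transfer (.imp (.lt (.var 0) (.var 1)) (.imp (.lt (.var 1) (.var 2)) (.lt (.var 0) (.var 2))))
    hTA (fun v h h' => Nat.lt_trans (n := v 0) h h') ![x, y, z]

theorem exists_num_of_ltA (hTA : M ⊨ trueArithmetic) {x : M} {m : ℕ} (h : ltA x (num M m)) :
    ∃ i < m, x = num M i := by
  induction m with
  | zero => exact absurd h (not_ltA_zero hTA x)
  | succ m ih =>
    rcases ltA_succ hTA x _ h with h | h
    · obtain ⟨i, hi, e⟩ := ih h
      exact ⟨i, hi.trans m.lt_succ_self, e⟩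
    · exact ⟨m, m.lt_succ_self, h⟩

theorem num_ltA_of_notMem_range (hTA : M ⊨ trueArithmetic) {a : M} (ha : a ∉ Set.range (num M))
    (m : ℕ) : ltA (num M m) a := by
  rcases ltA_trichotomy hTA (num M m) a with h | h | h
  · exact h
  · exact absurd ⟨m, h⟩ ha
  · obtain ⟨i, -, e⟩ := exists_num_of_ltA hTA h
    exact absurd ⟨i, e.symm⟩ ha

/-- Otherwise the numerals would give an isomorphism with `ℕ`. -/
theorem exists_notMem_range_num (hTA : M ⊨ trueArithmetic) (hM : IsNonstandard M) :
    ∃ a : M, a ∉ Set.range (num M) := by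
  by_contra! h
  let e : ℕ ≃ M := Equiv.ofBijective (num M) ⟨num_injective hTA, h⟩
  refine hM.false (Language.Equiv.symm ⟨e, ?_, ?_⟩)
  · intro n f v
    cases f with
    | zero =>
      exact congrArg (Structure.funMap (L := arith) ArithFunc.zero) (funext fun i => i.elim0)
    | one =>
      refine Eq.trans (num_one hTA) ?_
      exact congrArg (Structure.funMap (L := arith) ArithFunc.one) (funext fun i => i.elim0)
    | add =>
      refine (addA_num hTA (v 0) (v 1)).symm.trans ?_
      refine congrArg (Structure.funMap (L := arith) ArithFunc.add) (funext fun i => ?_)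
      fin_cases i <;> rfl
    | mul =>
      refine (mulA_num hTA (v 0) (v 1)).symm.trans ?_
      refine congrArg (Structure.funMap (L := arith) ArithFunc.mul) (funext fun i => ?_)
      fin_cases i <;> rfl
  · intro n r v
    cases r with
    | lt =>
      refine Iff.trans (iff_of_eq ?_) (ltA_num hTA (a := v 0) (b := v 1))
      refine congrArg (Structure.RelMap (L := arith) ArithRel.lt) (funext fun i => ?_)
      fin_cases i <;> rfl

theorem exists_entry (hTA : M ⊨ trueArithmetic) (x i : M) : ∃ v, Entry x i v := by
  have key : Dfn fun (N : Type) [arith.Structure N] (w : Fin 2 → N) =>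
    ∃ v, Entry (w 0) (w 1) v := .ex (dfn_entry _ _ _)
  exact key.transfer hTA (fun _ => ⟨_, (entry_nat _ _ _).2 rfl⟩) ![x, i]

theorem exists_agree_entry (hTA : M ⊨ trueArithmetic) (x l v : M) :
    ∃ x', Agree l x x' ∧ Entry x' l v := by
  have key : Dfn fun (N : Type) [arith.Structure N] (w : Fin 3 → N) =>
    ∃ x', Agree (w 1) (w 0) x' ∧ Entry x' (w 1) (w 2) :=
    .ex (.and (dfn_agree _ _ _) (dfn_entry _ _ _))
  refine key.transfer hTA (fun w => ?_) ![x, l, v]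
  obtain ⟨x', hx'⟩ := exists_entries_nat
    (fun i => if i < w 1 then Nat.beta (w 0) i else w 2) (w 1 + 1)
  refine ⟨x', (agree_nat _ _ _).2 fun i hi => ?_, (entry_nat _ _ _).2 ?_⟩
  · exact ((hx' i (Nat.lt_succ_of_lt hi)).trans (if_pos hi)).symm
  · exact (hx' _ (Nat.lt_succ_self _)).trans (if_neg (lt_irrefl _))

theorem Agree.refl (l x : M) : Agree l x x := fun _ _ _ => Iff.rfl

theorem Agree.symm {l x y : M} (h : Agree l x y) : Agree l y x := fun i hi v => (h i hi v).symm

theorem Agree.trans {l x y z : M} (h : Agree l x y) (h' : Agree l y z) : Agree l x z :=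
  fun i hi v => (h i hi v).trans (h' i hi v)

theorem Agree.mono (hTA : M ⊨ trueArithmetic) {x y : M} {l m : ℕ} (hlm : l ≤ m)
    (h : Agree (num M m) x y) : Agree (num M l) x y := fun i hi v => by
  obtain ⟨j, hj, rfl⟩ := exists_num_of_ltA hTA hi
  exact h _ ((ltA_num hTA).2 (hj.trans_le hlm)) v

/-- The sequence coded by `x` starts with the tuple `a`. -/
def Codes {l : ℕ} (x : M) (a : Fin l → M) : Prop := ∀ i : Fin l, Entry x (num M i) (a i)

theorem Codes.of_agree (hTA : M ⊨ trueArithmetic) {l : ℕ} {x y : M} {a : Fin l → M}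
    (h : Codes x a) (hxy : Agree (num M l) x y) : Codes y a := fun i =>
  (hxy _ ((ltA_num hTA).2 i.2) _).1 (h i)

theorem exists_extension (hTA : M ⊨ trueArithmetic) {l : ℕ} {x : M} {a : Fin l → M}
    (h : Codes x a) {m : ℕ} (b : Fin m → M) :
    ∃ x', Agree (num M l) x x' ∧ Codes x' (Fin.append a b) := by
  suffices H : ∃ x', Agree (num M l) x x' ∧ ∀ i : Fin m, Entry x' (num M (l + i)) (b i) by
    obtain ⟨x', hx', hb⟩ := H
    refine ⟨x', hx', fun i => ?_⟩
    refine Fin.addCases (fun i => ?_) (fun i => ?_) i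
    · simpa using h.of_agree hTA hx' i
    · simpa using hb i
  induction m with
  | zero => exact ⟨x, .refl _ _, fun i => i.elim0⟩
  | succ m ih =>
    obtain ⟨x', hx', hb⟩ := ih (fun i => b i.castSucc)
    obtain ⟨x'', hx'', hl⟩ := exists_agree_entry hTA x' (num M (l + m)) (b (Fin.last m))
    refine ⟨x'', hx'.trans (hx''.mono hTA (Nat.le_add_right _ _)), fun i => ?_⟩
    refine Fin.lastCases ?_ (fun i => ?_) i
    · exact hl
    · exact (hx'' _ ((ltA_num hTA).2 (by simp)) _).1 (hb i)

/-- Every code has an entry at every position, so a tuple of any standard length can be read off it.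
-/
theorem exists_extension_codes (hTA : M ⊨ trueArithmetic) {l : ℕ} {x : M} {a : Fin l → M}
    (h : Codes x a) (m : ℕ) : ∃ b : Fin m → M, Codes x (Fin.append a b) := by
  choose b hb using fun i : Fin m => exists_entry hTA x (num M (l + i))
  refine ⟨b, fun i => ?_⟩
  refine Fin.addCases (fun i => ?_) (fun i => ?_) i
  · simpa using h i
  · simpa using hb i

/-! ### Truncated back-and-forth relations and infinitary formulas -/

theorem BackForth.symm {k : M} {n : ℕ} {x y : M} (h : BackForth k n x y) : BackForth k n y x := by
  induction n generalizing x y with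
  | zero =>
    intro i j m hi hj hm p q r p' q' r' h1 h2 h3 h4 h5 h6
    obtain ⟨e1, e2, e3, e4, e5, e6⟩ := h i j m hi hj hm p' q' r' p q r h4 h5 h6 h1 h2 h3
    exact ⟨e1.symm, e2.symm, e3.symm, e4.symm, e5.symm, e6.symm⟩
  | succ n ih =>
    intro l hl
    refine ⟨fun y' hy' => ?_, fun x' hx' => ?_⟩
    · obtain ⟨x', hx', h'⟩ := (h l hl).2 y' hy'
      exact ⟨x', hx', ih h'⟩
    · obtain ⟨y', hy', h'⟩ := (h l hl).1 x' hx'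
      exact ⟨y', hy', ih h'⟩

variable {k : M} (hk : ∀ m, ltA (num M m) k)
include hk

theorem BackForth.sameAtomic {x y : M} (h : BackForth k 0 x y) {i j m : ℕ} {p q r p' q' r' : M}
    (h1 : Entry x (num M i) p) (h2 : Entry x (num M j) q) (h3 : Entry x (num M m) r)
    (h4 : Entry y (num M i) p') (h5 : Entry y (num M j) q') (h6 : Entry y (num M m) r') :
    SameAtomic p q r p' q' r' :=
  h _ _ _ (hk i) (hk j) (hk m) _ _ _ _ _ _ h1 h2 h3 h4 h5 h6

/-- `SameAtomic` sees only unnested formulas, so the values of subterms are stored at new positions,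
from `L` up to `L'`. Level `0` equivalence then forces the matching entries of `y''` to be the
values at `b`. Allowing any `x''` that agrees below `L'` leaves room to store further terms. -/
theorem exists_term_code (hTA : M ⊨ trueArithmetic) {l : ℕ} (t : arith.Term (Fin l ⊕ Fin 0))
    (a : Fin l → M) {L : ℕ} (hL : l ≤ L) {x : M} (hx : Codes x a) :
    ∃ (x' : M) (j L' : ℕ), Agree (num M L) x x' ∧ L ≤ L' ∧
      ∀ x'' y'' : M, Agree (num M L') x' x'' → BackForth k 0 x'' y'' → ∀ b, Codes y'' b →
        Entry x'' (num M j) (t.realize (Sum.elim a default)) ∧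
        Entry y'' (num M j) (t.realize (Sum.elim b default)) := by
  induction t generalizing L x with
  | var i =>
    rcases i with i | i
    · exact ⟨x, i, L, .refl _ _, le_rfl, fun x'' y'' h _ b hb =>
        ⟨hx.of_agree hTA (h.mono hTA hL) i, hb i⟩⟩
    · exact i.elim0
  | func f ts ih =>
    cases f with
    | zero =>
      obtain ⟨x', hx', he⟩ := exists_agree_entry hTA x (num M L) zeroA
      refine ⟨x', L, L + 1, hx', L.le_succ, fun x'' y'' h hbf b hb => ?_⟩
      have h1 := (h _ ((ltA_num hTA).2 L.lt_succ_self) _).1 he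
      obtain ⟨w, hw⟩ := exists_entry hTA y'' (num M L)
      obtain ⟨-, -, -, -, e, -⟩ := hbf.sameAtomic hk h1 h1 h1 hw hw hw
      obtain rfl := e.1 rfl
      have hz : ∀ c : Fin l → M, (Term.func (L := arith) ArithFunc.zero ts).realize
          (Sum.elim c (default : Fin 0 → M)) = zeroA := fun c =>
        congrArg (Structure.funMap (L := arith) ArithFunc.zero) (funext fun i => i.elim0)
      exact ⟨(hz a).symm ▸ h1, (hz b).symm ▸ hw⟩
    | one =>
      obtain ⟨x', hx', he⟩ := exists_agree_entry hTA x (num M L) oneA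
      refine ⟨x', L, L + 1, hx', L.le_succ, fun x'' y'' h hbf b hb => ?_⟩
      have h1 := (h _ ((ltA_num hTA).2 L.lt_succ_self) _).1 he
      obtain ⟨w, hw⟩ := exists_entry hTA y'' (num M L)
      obtain ⟨-, -, -, -, -, e⟩ := hbf.sameAtomic hk h1 h1 h1 hw hw hw
      obtain rfl := e.1 rfl
      have hz : ∀ c : Fin l → M, (Term.func (L := arith) ArithFunc.one ts).realize
          (Sum.elim c (default : Fin 0 → M)) = oneA := fun c =>
        congrArg (Structure.funMap (L := arith) ArithFunc.one) (funext fun i => i.elim0)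
      exact ⟨(hz a).symm ▸ h1, (hz b).symm ▸ hw⟩
    | add =>
      obtain ⟨x₁, j₁, L₁, hx₁, hL₁, H₁⟩ := ih 0 hL hx
      obtain ⟨x₂, j₂, L₂, hx₂, hL₂, H₂⟩ := ih 1 (hL.trans hL₁) (hx.of_agree hTA (hx₁.mono hTA hL))
      obtain ⟨x₃, hx₃, he⟩ := exists_agree_entry hTA x₂ (num M L₂)
        (addA ((ts 0).realize (Sum.elim a default)) ((ts 1).realize (Sum.elim a default)))
      refine ⟨x₃, L₂, L₂ + 1, hx₁.trans ((hx₂.trans (hx₃.mono hTA hL₂)).mono hTA hL₁),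
        (hL₁.trans hL₂).trans L₂.le_succ, fun x'' y'' h hbf b hb => ?_⟩
      have h₂ := hx₃.trans (h.mono hTA L₂.le_succ)
      have h3 := (h _ ((ltA_num hTA).2 L₂.lt_succ_self) _).1 he
      obtain ⟨p, p'⟩ := H₁ x'' y'' (hx₂.trans (h₂.mono hTA hL₂)) hbf b hb
      obtain ⟨q, q'⟩ := H₂ x'' y'' h₂ hbf b hb
      obtain ⟨w, hw⟩ := exists_entry hTA y'' (num M L₂)
      obtain ⟨-, -, e, -, -, -⟩ := hbf.sameAtomic hk p q h3 p' q' hw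
      obtain rfl := e.1 rfl
      have hz : ∀ c : Fin l → M, (Term.func (L := arith) ArithFunc.add ts).realize
          (Sum.elim c (default : Fin 0 → M)) = addA ((ts 0).realize (Sum.elim c default))
            ((ts 1).realize (Sum.elim c default)) := fun c =>
        congrArg (Structure.funMap (L := arith) ArithFunc.add)
          (funext fun i => by fin_cases i <;> rfl)
      exact ⟨(hz a).symm ▸ h3, (hz b).symm ▸ hw⟩
    | mul =>
      obtain ⟨x₁, j₁, L₁, hx₁, hL₁, H₁⟩ := ih 0 hL hx
      obtain ⟨x₂, j₂, L₂, hx₂, hL₂, H₂⟩ := ih 1 (hL.trans hL₁) (hx.of_agree hTA (hx₁.mono hTA hL))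
      obtain ⟨x₃, hx₃, he⟩ := exists_agree_entry hTA x₂ (num M L₂)
        (mulA ((ts 0).realize (Sum.elim a default)) ((ts 1).realize (Sum.elim a default)))
      refine ⟨x₃, L₂, L₂ + 1, hx₁.trans ((hx₂.trans (hx₃.mono hTA hL₂)).mono hTA hL₁),
        (hL₁.trans hL₂).trans L₂.le_succ, fun x'' y'' h hbf b hb => ?_⟩
      have h₂ := hx₃.trans (h.mono hTA L₂.le_succ)
      have h3 := (h _ ((ltA_num hTA).2 L₂.lt_succ_self) _).1 he
      obtain ⟨p, p'⟩ := H₁ x'' y'' (hx₂.trans (h₂.mono hTA hL₂)) hbf b hb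
      obtain ⟨q, q'⟩ := H₂ x'' y'' h₂ hbf b hb
      obtain ⟨w, hw⟩ := exists_entry hTA y'' (num M L₂)
      obtain ⟨-, -, -, e, -, -⟩ := hbf.sameAtomic hk p q h3 p' q' hw
      obtain rfl := e.1 rfl
      have hz : ∀ c : Fin l → M, (Term.func (L := arith) ArithFunc.mul ts).realize
          (Sum.elim c (default : Fin 0 → M)) = mulA ((ts 0).realize (Sum.elim c default))
            ((ts 1).realize (Sum.elim c default)) := fun c =>
        congrArg (Structure.funMap (L := arith) ArithFunc.mul)
          (funext fun i => by fin_cases i <;> rfl)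
      exact ⟨(hz a).symm ▸ h3, (hz b).symm ▸ hw⟩

/-- One forth move stores the values of both terms; this is why level `1` is assumed. -/
theorem sameAtomic_terms (hTA : M ⊨ trueArithmetic) {l : ℕ}
    (s t : arith.Term (Fin l ⊕ Fin 0)) {a b : Fin l → M} {x y : M} (hx : Codes x a)
    (hy : Codes y b) (h : BackForth k 1 x y) :
    SameAtomic (s.realize (Sum.elim a default)) (t.realize (Sum.elim a default))
      (s.realize (Sum.elim a default)) (s.realize (Sum.elim b default))
      (t.realize (Sum.elim b default)) (s.realize (Sum.elim b (default : Fin 0 → M))) := by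
  obtain ⟨x₁, j₁, L₁, hx₁, hL₁, H₁⟩ := exists_term_code hk hTA s a le_rfl hx
  obtain ⟨x₂, j₂, L₂, hx₂, hL₂, H₂⟩ := exists_term_code hk hTA t a hL₁ (hx.of_agree hTA hx₁)
  obtain ⟨y', hy', h'⟩ := (h _ (hk l)).1 x₂ (hx₁.trans (hx₂.mono hTA hL₁))
  obtain ⟨p, p'⟩ := H₁ x₂ y' hx₂ h' b (hy.of_agree hTA hy')
  obtain ⟨q, q'⟩ := H₂ x₂ y' (.refl _ _) h' b (hy.of_agree hTA hy')
  exact h'.sameAtomic hk p q p p' q' p'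

theorem realize_qf_iff_of_backForth (hTA : M ⊨ trueArithmetic) {l : ℕ}
    {φ : arith.Formula (Fin l)} (hφ : BoundedFormula.IsQF φ) {a b : Fin l → M} {x y : M}
    (hx : Codes x a) (hy : Codes y b) (h : BackForth k 1 x y) : φ.Realize a ↔ φ.Realize b := by
  unfold Formula.Realize
  induction hφ with
  | falsum => exact Iff.rfl
  | of_isAtomic hφ =>
    cases hφ with
    | equal s t => exact (sameAtomic_terms hk hTA s t hx hy h).2.1
    | rel R ts =>
      cases R with
      | lt =>
        have hz : ∀ c : Fin l → M, BoundedFormula.Realize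
            (Relations.boundedFormula (L := arith) ArithRel.lt ts) c (default : Fin 0 → M) ↔
            ltA ((ts 0).realize (Sum.elim c default)) ((ts 1).realize (Sum.elim c default)) :=
          fun c => iff_of_eq (congrArg (Structure.RelMap (L := arith) ArithRel.lt)
            (funext fun i => by fin_cases i <;> rfl))
        exact (hz a).trans ((sameAtomic_terms hk hTA (ts 0) (ts 1) hx hy h).1.trans
          (hz b).symm)
  | imp _ _ ih₁ ih₂ => simp only [BoundedFormula.realize_imp, ih₁, ih₂]

/-- Each quantifier block costs one move, and one more level is kept for nested terms at the bottom.
-/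
theorem realize_iff_of_backForth (hTA : M ⊨ trueArithmetic) (n : ℕ) {l : ℕ} {a b : Fin l → M}
    {x y : M} (hx : Codes x a) (hy : Codes y b) (h : BackForth k (n + 1) x y)
    {β : Ordinal.{0}} (hβ : β ≤ n) {φ : InfFormula arith l} (hφ : φ.IsSigma β ∨ φ.IsPi β) :
    φ.Realize a ↔ φ.Realize b := by
  induction n generalizing l a b x y β φ with
  | zero =>
    have hβ : β ≤ 0 := by simpa using hβ
    rcases hφ with hφ | hφ
    · cases hφ with
      | qf φ hφ => exact realize_qf_iff_of_backForth hk hTA hφ hx hy h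
      | disj α k ψ β hβ' hψ => exact absurd ((hβ' 0).trans_le hβ) not_lt_zero
    · cases hφ with
      | qf φ hφ => exact realize_qf_iff_of_backForth hk hTA hφ hx hy h
      | conj α k ψ β hβ' hψ => exact absurd ((hβ' 0).trans_le hβ) not_lt_zero
  | succ n ih =>
    have hqf : ∀ (φ : arith.Formula (Fin l)), BoundedFormula.IsQF φ →
        (φ.Realize a ↔ φ.Realize b) := fun φ hφ => by
      -- A move that leaves `x` unchanged lowers the level.
      obtain ⟨y', hy', h'⟩ := (h _ (hk l)).1 x (.refl _ _)
      exact ih hx (hy.of_agree hTA hy') h' zero_le (Or.inl (.qf φ hφ))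
    have hlt : ∀ {β'}, β' < β → β' ≤ (n : Ordinal.{0}) := fun h => by
      have := h.trans_le hβ
      rw [Nat.cast_succ] at this
      exact Order.lt_add_one_iff.1 this
    have forth : ∀ {m : ℕ} (c : Fin m → M), ∃ (d : Fin m → M) (x' y' : M),
        Codes x' (Fin.append a c) ∧ Codes y' (Fin.append b d) ∧ BackForth k (n + 1) x' y' :=
      fun c => by
        obtain ⟨x', hx', hc⟩ := exists_extension hTA hx c
        obtain ⟨y', hy', h'⟩ := (h _ (hk l)).1 x' hx'
        obtain ⟨d, hd⟩ := exists_extension_codes hTA (hy.of_agree hTA hy') _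
        exact ⟨d, x', y', hc, hd, h'⟩
    have back : ∀ {m : ℕ} (d : Fin m → M), ∃ (c : Fin m → M) (x' y' : M),
        Codes x' (Fin.append a c) ∧ Codes y' (Fin.append b d) ∧ BackForth k (n + 1) x' y' :=
      fun d => by
        obtain ⟨y', hy', hd⟩ := exists_extension hTA hy d
        obtain ⟨x', hx', h'⟩ := (h _ (hk l)).2 y' hy'
        obtain ⟨c, hc⟩ := exists_extension_codes hTA (hx.of_agree hTA hx') _
        exact ⟨c, x', y', hc, hd, h'⟩
    rcases hφ with hφ | hφ
    · cases hφ with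
      | qf φ hφ => exact hqf φ hφ
      | disj α m ψ β hβ' hψ =>
        simp only [InfFormula.Realize]
        refine exists_congr fun i => ⟨fun ⟨c, hc⟩ => ?_, fun ⟨d, hd⟩ => ?_⟩
        · obtain ⟨d, x', y', hx', hy', h'⟩ := forth c
          exact ⟨d, (ih hx' hy' h' (hlt (hβ' i)) (Or.inr (hψ i))).1 hc⟩
        · obtain ⟨c, x', y', hx', hy', h'⟩ := back d
          exact ⟨c, (ih hx' hy' h' (hlt (hβ' i)) (Or.inr (hψ i))).2 hd⟩
    · cases hφ with
      | qf φ hφ => exact hqf φ hφ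
      | conj α m ψ β hβ' hψ =>
        simp only [InfFormula.Realize]
        refine forall_congr' fun i => ⟨fun H d => ?_, fun H c => ?_⟩
        · obtain ⟨c, x', y', hx', hy', h'⟩ := back d
          exact (ih hx' hy' h' (hlt (hβ' i)) (Or.inl (hψ i))).1 (H c)
        · obtain ⟨d, x', y', hx', hy', h'⟩ := forth c
          exact (ih hx' hy' h' (hlt (hβ' i)) (Or.inl (hψ i))).2 (H d)

end Model

/-! ### No orbit of a nonstandard element is definable at a finite level -/

section Model

variable {M : Type} [arith.Structure M]

/-- For standard `k` the bound `B` from `ℕ` is standard, hence below `a`. -/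
theorem exists_ltA_backForthElem (hTA : M ⊨ trueArithmetic) {a : M} (ha : ∀ m, ltA (num M m) a)
    (n k : ℕ) : ∃ b, ltA b a ∧ BackForthElem n (num M k) a b := by
  obtain ⟨B, hB⟩ := exists_bound_backForthElem n k
  have key : Dfn fun (N : Type) [arith.Structure N] (w : Fin 2 → N) =>
      ∀ a, ∃ b, ltA b (w 0) ∧ BackForthElem n (w 1) a b :=
    .all (.ex (.and (.lt (.var _) (.var _)) (dfn_backForthElem _ _ _ _)))
  obtain ⟨b, hb, h⟩ := (key.num_iff hTA ![B, k]).2 hB a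
  exact ⟨b, ltA_trans hTA hb (ha B), h⟩

/-- Overspill: the maximal truncation cannot be a numeral `m`, because `m + 1` also works. -/
theorem exists_smaller_of_nonstandard (hTA : M ⊨ trueArithmetic) {a : M}
    (ha : ∀ m, ltA (num M m) a) (n : ℕ) :
    ∃ b k, (∀ m, ltA (num M m) k) ∧ BackForthElem n k a b ∧ Smaller n a b := by
  -- Truncation `0` shows that some truncation works, so a maximal one exists.
  obtain ⟨z, hz, hR⟩ := exists_ltA_backForthElem hTA ha n 0
  have key : Dfn fun (N : Type) [arith.Structure N] (w : Fin 3 → N) =>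
      ltA (w 1) (w 0) → ltA (w 2) (w 0) → BackForthElem n (w 1) (w 0) (w 2) →
        ∃ y, Smaller n (w 0) y :=
    .imp (.lt (.var _) (.var _)) (.imp (.lt (.var _) (.var _))
      (.imp (dfn_backForthElem _ _ _ _) (.ex (dfn_smaller _ _ _))))
  obtain ⟨b, hb⟩ := key.transfer hTA (fun _ => exists_smaller) ![a, num M 0, z] (ha 0) hz hR
  have hb' := hb
  obtain ⟨k, hka, -, hab, -, hmax⟩ := hb
  refine ⟨b, k, num_ltA_of_notMem_range hTA ?_, hab, hb'⟩
  rintro ⟨m, rfl⟩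
  obtain ⟨z, hz, hR⟩ := exists_ltA_backForthElem hTA ha n (m + 1)
  exact hmax _ (ha _) ((ltA_num hTA).2 m.lt_succ_self) z hz hR

theorem notMem_autOrbit_of_smaller (hTA : M ⊨ trueArithmetic) {n : ℕ} {a b : M}
    (h : Smaller n a b) : ![b] ∉ autOrbit arith ![a] := by
  rintro ⟨σ, hσ⟩
  have hσ : σ a = b := hσ 0
  have key : Dfn fun (N : Type) [arith.Structure N] (w : Fin 2 → N) =>
      Smaller n (w 0) (w 1) → (Coloured n (w 0) ↔ ¬ Coloured n (w 1)) :=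
    .imp (dfn_smaller _ _ _) (.iff (dfn_coloured _ _) (.not (dfn_coloured _ _)))
  have h1 : Coloured n a ↔ ¬ Coloured n b :=
    key.transfer hTA (fun _ => coloured_of_smaller) ![a, b] h
  have h2 : Coloured n (σ a) ↔ Coloured n a := (dfn_coloured n (0 : Fin 1)).equiv_iff σ ![a]
  rw [hσ] at h2
  tauto

/-- A `Σ^in_α` formula with `α ≤ ω` that holds at a tuple is implied by a formula of finite level
that holds at the tuple. -/
theorem exists_isSigma_nat {L : FirstOrder.Language.{0, 0}} {A : Type*} [L.Structure A] {l : ℕ}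
    {φ : InfFormula L l} {α : Ordinal.{0}} (hα : α ≤ Ordinal.omega0) (hφ : φ.IsSigma α)
    {a : Fin l → A} (ha : φ.Realize a) :
    ∃ (n : ℕ) (ψ : InfFormula L l), ψ.IsSigma n ∧ ψ.Realize a ∧
      ∀ b : Fin l → A, ψ.Realize b → φ.Realize b := by
  cases hφ with
  | qf φ hφ => exact ⟨0, .qf φ hφ, by simpa using InfFormula.IsSigma.qf φ hφ, ha, fun _ => id⟩
  | disj α k ψ β hβ hψ =>
    obtain ⟨i, hi⟩ := ha
    obtain ⟨n, hn⟩ := Ordinal.lt_omega0.1 ((hβ i).trans_le hα)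
    -- The true disjunct, repeated; its matrix has level below `ω`, hence finite.
    refine ⟨n + 1, .disj fun _ => .exs (k i) (ψ i), ?_, ⟨0, hi⟩, fun b ⟨_, hb⟩ => ⟨i, hb⟩⟩
    refine .disj _ (fun _ => k i) (fun _ => ψ i) (fun _ => β i) (fun _ => ?_) (fun _ => hψ i)
    rw [hn]
    exact_mod_cast n.lt_succ_self

theorem not_orbitsSigmaDefinable (hTA : M ⊨ trueArithmetic) (hM : IsNonstandard M)
    {α : Ordinal.{0}} (hα : α ≤ Ordinal.omega0) : ¬ OrbitsSigmaDefinable arith M α := by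
  intro H
  obtain ⟨a, ha⟩ := exists_notMem_range_num hTA hM
  obtain ⟨φ, hφ, hdef⟩ := H 1 ![a]
  obtain ⟨n, ψ, hψ, hψa, himp⟩ := exists_isSigma_nat hα hφ
    ((hdef ![a]).2 ⟨.refl arith M, fun _ => rfl⟩)
  obtain ⟨b, k, hk, ⟨x, y, hx, hy, hxy⟩, hab⟩ :=
    exists_smaller_of_nonstandard hTA (num_ltA_of_notMem_range hTA ha) (n + 1)
  have codes : ∀ {x a : M}, Entry x zeroA a → Codes x ![a] := fun h i => by
    obtain rfl := Subsingleton.elim i 0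
    exact h
  exact notMem_autOrbit_of_smaller hTA hab ((hdef _).1 (himp _
    ((realize_iff_of_backForth hk hTA n (codes hx) (codes hy) hxy le_rfl (Or.inl hψ)).1 hψa)))

end Model

/-! ### Scott's theorem: the Scott rank of a countable structure exists -/

section Scott

variable {L : FirstOrder.Language.{0, 0}}

/-- The negation of an infinitary formula. -/
def InfFormula.neg : {n : ℕ} → InfFormula L n → InfFormula L n
  | _, .qf φ hφ => .qf φ.not hφ.not
  | _, .disj f => .conj fun i => InfFormula.neg (f i)
  | _, .conj f => .disj fun i => InfFormula.neg (f i)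
  | _, .exs k φ => .alls k (InfFormula.neg φ)
  | _, .alls k φ => .exs k (InfFormula.neg φ)

theorem InfFormula.realize_neg {M : Type*} [L.Structure M] {n : ℕ} (φ : InfFormula L n)
    (a : Fin n → M) : (InfFormula.neg φ).Realize a ↔ ¬ φ.Realize a := by
  induction φ with
  | qf φ hφ => exact Formula.realize_not
  | disj f ih | conj f ih | exs k φ ih | alls k φ ih =>
    simp only [InfFormula.neg, InfFormula.Realize, ih, not_exists, not_forall]

theorem InfFormula.isPi_neg {n : ℕ} {α : Ordinal.{0}} {φ : InfFormula L n} (h : φ.IsSigma α) :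
    (InfFormula.neg φ).IsPi α := by
  refine InfFormula.IsSigma.rec
    (motive_1 := fun {n} α φ _ => (InfFormula.neg φ).IsPi α)
    (motive_2 := fun {n} α φ _ => (InfFormula.neg φ).IsSigma α) ?_ ?_ ?_ ?_ h
  · exact fun φ hφ => .qf _ hφ.not
  · exact fun α k ψ β hβ _ ih => .conj α k _ β hβ ih
  · exact fun φ hφ => .qf _ hφ.not
  · exact fun α k ψ β hβ _ ih => .disj α k _ β hβ ih

theorem isSigma_disj_exs {n : ℕ} {α β : Ordinal.{0}} (hβ : β < α) {k : ℕ}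
    {φ : InfFormula L (n + k)} (h : φ.IsPi β) :
    (InfFormula.disj fun _ => .exs k φ).IsSigma α :=
  .disj α (fun _ => k) (fun _ => φ) (fun _ => β) (fun _ => hβ) (fun _ => h)

/-- An empty quantifier block turns a `Π` formula into the shape required of a `Σ` formula. -/
theorem realize_disj_exs_zero {M : Type*} [L.Structure M] {n : ℕ} {φ : InfFormula L n}
    {a : Fin n → M} :
    (InfFormula.disj fun _ => .exs 0 φ : InfFormula L n).Realize a ↔ φ.Realize a := by
  simp only [InfFormula.Realize, exists_const]
  refine ⟨fun ⟨b, hb⟩ => ?_, fun h => ⟨Fin.elim0, ?_⟩⟩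
  · rwa [Fin.append_right_nil _ _ rfl] at hb
  · rwa [Fin.append_right_nil _ _ rfl]

theorem realize_conj_alls_zero {M : Type*} [L.Structure M] {n : ℕ} {f : ℕ → InfFormula L n}
    {a : Fin n → M} :
    (InfFormula.conj fun i => .alls 0 (f i) : InfFormula L n).Realize a ↔
      ∀ i, (f i).Realize a := by
  simp only [InfFormula.Realize]
  refine forall_congr' fun i => ⟨fun h => ?_, fun h b => ?_⟩
  · have := h Fin.elim0
    rwa [Fin.append_right_nil _ _ rfl] at this
  · rwa [Fin.append_right_nil _ _ rfl]

theorem add_one_lt_omega_one {α : Ordinal.{0}} (h : α < Ordinal.omega 1) :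
    α + 1 < Ordinal.omega 1 :=
  (Cardinal.isSuccLimit_omega 1).add_one_lt h

theorem exists_bound_lt_omega_one {ι : Type*} [Countable ι] (f : ι → Ordinal.{0})
    (h : ∀ i, f i < Ordinal.omega 1) : ∃ γ < Ordinal.omega 1, ∀ i, f i < γ := by
  refine ⟨⨆ i, f i + 1, Ordinal.iSup_lt_omega_one fun i => add_one_lt_omega_one (h i),
    fun i => (lt_add_one (f i)).trans_le (le_ciSup (f := fun i => f i + 1) ?_ i)⟩
  exact ⟨Ordinal.omega 1, by rintro _ ⟨i, rfl⟩; exact (add_one_lt_omega_one (h i)).le⟩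

variable {M : Type*} [L.Structure M]

/-- Every `Σ^in_α` formula, `α < ω₁`, that holds at `a` holds at `b`. -/
def SigmaIncl {n : ℕ} (L : FirstOrder.Language.{0, 0}) [L.Structure M] (a b : Fin n → M) : Prop :=
  ∀ α < Ordinal.omega 1, ∀ φ : InfFormula L n, φ.IsSigma α → φ.Realize a → φ.Realize b

/-- The negation of a `Σ_α` formula is `Π_α`, hence equivalent to a `Σ_{α+1}` formula, and `α + 1 <
ω₁`. -/
theorem SigmaIncl.symm {n : ℕ} {a b : Fin n → M} (h : SigmaIncl L a b) : SigmaIncl L b a := by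
  intro α hα φ hφ hb
  by_contra ha
  have := h (α + 1) (add_one_lt_omega_one hα) _
    (isSigma_disj_exs (k := 0) (lt_add_one α) (InfFormula.isPi_neg hφ))
    (realize_disj_exs_zero.2 ((InfFormula.realize_neg φ a).2 ha))
  exact (InfFormula.realize_neg φ b).1 (realize_disj_exs_zero.1 this) hb

theorem SigmaIncl.realize_qf_iff {n : ℕ} {a b : Fin n → M} (h : SigmaIncl L a b)
    {φ : L.Formula (Fin n)} (hφ : BoundedFormula.IsQF φ) : φ.Realize a ↔ φ.Realize b :=
  ⟨h 0 (Ordinal.omega_pos 1) (.qf φ hφ) (.qf φ hφ),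
    h.symm 0 (Ordinal.omega_pos 1) (.qf φ hφ) (.qf φ hφ)⟩

/-- If each `d` failed through some formula, the countable conjunction of these would be `Π_γ` with
`γ < ω₁`; its existential closure holds at `a`, hence at `b`, and a witness contradicts its own
conjunct. -/
theorem SigmaIncl.exists_append [Countable M] {n m : ℕ} {a b : Fin n → M} (h : SigmaIncl L a b)
    (c : Fin m → M) : ∃ d : Fin m → M, SigmaIncl L (Fin.append a c) (Fin.append b d) := by
  by_contra! H
  unfold SigmaIncl at H
  push Not at H
  choose α hα φ hφ hac hbd using H
  have : Nonempty (Fin m → M) := ⟨c⟩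
  obtain ⟨γ, hγ, hαγ⟩ := exists_bound_lt_omega_one α hα
  obtain ⟨e, he⟩ := exists_surjective_nat (Fin m → M)
  have hpi : (InfFormula.conj fun i => .alls 0 (φ (e i)) : InfFormula L (n + m)).IsPi γ :=
    .conj γ (fun _ => 0) (fun i => φ (e i)) (fun i => α (e i)) (fun i => hαγ _) (fun i => hφ _)
  obtain ⟨-, d, hd⟩ := h (γ + 1) (add_one_lt_omega_one hγ) _ (isSigma_disj_exs (lt_add_one γ) hpi)
    ⟨0, c, realize_conj_alls_zero.2 fun i => hac _⟩
  obtain ⟨i, rfl⟩ := he d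
  exact hbd _ (realize_conj_alls_zero.1 hd i)

theorem SigmaIncl.exists_update [Countable M] {n : ℕ} {a b : ℕ → M}
    (h : SigmaIncl L (fun i : Fin n => a i) (fun i : Fin n => b i)) (c : M) :
    ∃ d, SigmaIncl L (fun i : Fin (n + 1) => Function.update a n c i)
      (fun i : Fin (n + 1) => Function.update b n d i) := by
  obtain ⟨d, hd⟩ := h.exists_append ![c]
  have key : ∀ (a : ℕ → M) (c : M), (fun i : Fin (n + 1) => Function.update a n c i) =
      Fin.append (fun i : Fin n => a i) ![c] := fun a c => by
    funext i
    refine Fin.addCases (fun i => ?_) (fun i => ?_) i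
    · simp [Function.update_of_ne i.2.ne]
    · simp
  refine ⟨d 0, ?_⟩
  rw [key, key]
  convert hd
  funext i
  obtain rfl := Subsingleton.elim i 0
  rfl

/-- Two sequences with the same `Σ^in` types of initial segments that enumerate a structure define
an automorphism. -/
theorem exists_equiv_of_sigmaIncl {a b : ℕ → M} (ha : Function.Surjective a)
    (hb : Function.Surjective b)
    (h : ∀ N, ∃ n ≥ N, SigmaIncl L (fun i : Fin n => a i) (fun i : Fin n => b i)) :
    ∃ σ : M ≃[L] M, ∀ i, σ (a i) = b i := by
  have hinj : ∀ i j, a i = a j ↔ b i = b j := fun i j => by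
    obtain ⟨n, hn, hab⟩ := h (max i j + 1)
    have := hab.realize_qf_iff (φ := (Term.var ⟨i, by omega⟩ : L.Term (Fin n)).equal
      (Term.var ⟨j, by omega⟩)) (BoundedFormula.IsAtomic.equal _ _).isQF
    simpa [Formula.realize_equal] using this
  let s := Function.surjInv ha
  have hs : ∀ x, a (s x) = x := Function.surjInv_eq ha
  have hf : ∀ i, b (s (a i)) = b i := fun i => (hinj _ _).1 (hs _)
  let e : M ≃ M := Equiv.ofBijective (fun x => b (s x)) ⟨fun x y hxy => by
    rw [← hs x, ← hs y]; exact (hinj _ _).2 hxy, fun y => by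
    obtain ⟨i, rfl⟩ := hb y
    exact ⟨a i, hf i⟩⟩
  have hbound : ∀ {k : ℕ} (v : Fin k → M), ∃ N, ∀ i, s (v i) < N := fun v => by
    obtain ⟨B, hB⟩ := (Set.finite_range fun i => s (v i)).bddAbove
    exact ⟨B + 1, fun i => Nat.lt_succ_of_le (hB ⟨i, rfl⟩)⟩
  refine ⟨⟨e, ?_, ?_⟩, hf⟩
  · intro k f v
    obtain ⟨N, hN⟩ := hbound v
    obtain ⟨j, hj⟩ := ha (Structure.funMap f v)
    obtain ⟨n, hn, hab⟩ := h (max N (j + 1))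
    have := hab.realize_qf_iff (φ := (Term.func f fun i => (Term.var
      ⟨s (v i), ((hN i).trans_le (le_max_left _ _)).trans_le hn⟩ : L.Term (Fin n))).equal
      (Term.var ⟨j, by omega⟩)) (BoundedFormula.IsAtomic.equal _ _).isQF
    simp only [Formula.realize_equal, Term.realize_func, Term.realize_var, hs] at this
    have := this.1 hj.symm
    show b (s (Structure.funMap f v)) = _
    rw [← hj, hf, ← this]
    rfl
  · intro k R v
    obtain ⟨N, hN⟩ := hbound v
    obtain ⟨n, hn, hab⟩ := h N
    have := hab.realize_qf_iff (φ := Relations.formula R fun i => (Term.var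
      ⟨s (v i), (hN i).trans_le hn⟩ : L.Term (Fin n))) (BoundedFormula.IsAtomic.rel _ _).isQF
    simp only [Formula.realize_rel, Term.realize_var, hs] at this
    exact this.symm

theorem SigmaIncl.mem_autOrbit [Countable M] [Nonempty M] {n : ℕ} {a b : Fin n → M}
    (h : SigmaIncl L a b) : b ∈ autOrbit L a := by
  obtain ⟨e, he⟩ := exists_surjective_nat M
  -- A state is a pair of sequences with the length up to which they matter. Step `t` puts `e t`
  -- first on the left, then on the right, so the length grows by two.
  let S := {p : (ℕ → M) × (ℕ → M) × ℕ //
    SigmaIncl L (fun i : Fin p.2.2 => p.1 i) (fun i : Fin p.2.2 => p.2.1 i)}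
  have step : ∀ (t : ℕ) (p : S), ∃ q : S, q.1.2.2 = p.1.2.2 + 2 ∧
      (∀ i < p.1.2.2, q.1.1 i = p.1.1 i ∧ q.1.2.1 i = p.1.2.1 i) ∧
      q.1.1 p.1.2.2 = e t ∧ q.1.2.1 (p.1.2.2 + 1) = e t := by
    rintro t ⟨⟨f, g, k⟩, hp⟩
    obtain ⟨d, hd⟩ := SigmaIncl.exists_update hp (e t)
    obtain ⟨c, hc⟩ := SigmaIncl.exists_update hd.symm (e t)
    refine ⟨⟨(Function.update (Function.update f k (e t)) (k + 1) c,
      Function.update (Function.update g k d) (k + 1) (e t), k + 2), hc.symm⟩, rfl,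
      fun i hi => ⟨?_, ?_⟩, ?_, ?_⟩ <;>
      simp only [Function.update_apply] <;> split_ifs <;> first | rfl | (simp only at *; omega)
  choose nxt hlen hagree hforth hback using step
  obtain ⟨x⟩ := ‹Nonempty M›
  let ext : (Fin n → M) → ℕ → M := fun c i => if hi : i < n then c ⟨i, hi⟩ else x
  have hext : ∀ c : Fin n → M, (fun i : Fin n => ext c i) = c := fun c => by
    funext i; simp [ext]
  let st : ℕ → S := fun t => Nat.rec ⟨(ext a, ext b, n), by simpa only [hext] using h⟩ nxt t
  have hst : ∀ t, st (t + 1) = nxt t (st t) := fun _ => rfl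
  have hn : ∀ t, (st t).1.2.2 = n + 2 * t := fun t => by
    induction t with
    | zero => rfl
    | succ t ih => rw [hst, hlen, ih]; ring
  have hmono : ∀ t u i, i < n + 2 * t → (st (t + u)).1.1 i = (st t).1.1 i ∧
      (st (t + u)).1.2.1 i = (st t).1.2.1 i := fun t u i hi => by
    induction u with
    | zero => exact ⟨rfl, rfl⟩
    | succ u ih =>
      obtain ⟨h1, h2⟩ := hagree (t + u) (st (t + u)) i (by rw [hn]; omega)
      exact ⟨h1.trans ih.1, h2.trans ih.2⟩
  let A : ℕ → M := fun i => (st (i + 1)).1.1 i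
  let B : ℕ → M := fun i => (st (i + 1)).1.2.1 i
  have hAB : ∀ t i, i < n + 2 * t → (st t).1.1 i = A i ∧ (st t).1.2.1 i = B i := fun t i hi => by
    have h1 := hmono t (i + 1) i hi
    have h2 := hmono (i + 1) t i (by omega)
    rw [add_comm (i + 1) t] at h2
    exact ⟨h1.1.symm.trans h2.1, h1.2.symm.trans h2.2⟩
  obtain ⟨σ, hσ⟩ := exists_equiv_of_sigmaIncl (L := L) (a := A) (b := B)
    (fun y => by
      obtain ⟨t, rfl⟩ := he y
      refine ⟨n + 2 * t, ?_⟩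
      rw [← (hAB (t + 1) _ (by omega)).1, ← hforth t (st t), hst, hn])
    (fun y => by
      obtain ⟨t, rfl⟩ := he y
      refine ⟨n + 2 * t + 1, ?_⟩
      rw [← (hAB (t + 1) _ (by omega)).2, ← hback t (st t), hst, hn])
    (fun N => ⟨n + 2 * N, by omega, by
      have := (st N).2
      rw [hn] at this
      convert this using 2 with i i
      · exact (hAB N i i.2).1.symm
      · exact (hAB N i i.2).2.symm⟩)
  refine ⟨σ, fun i => ?_⟩
  have h0 := hAB 0 i (by have := i.2; omega)
  have e1 : A i = a i := h0.1.symm.trans (congrFun (hext a) i)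
  have e2 : B i = b i := h0.2.symm.trans (congrFun (hext b) i)
  rw [← e1, ← e2, hσ]

theorem realize_of_mem_autOrbit {n : ℕ} {a b : Fin n → M} (h : b ∈ autOrbit L a)
    {φ : InfFormula L n} (hφ : φ.Realize a) : φ.Realize b := by
  obtain ⟨σ, hσ⟩ := h
  have : b = σ ∘ a := funext fun i => (hσ i).symm
  rw [this]
  exact (realize_comp_equiv σ φ a).2 hφ

variable (L M) in
/-- Scott's theorem: the automorphism orbits of a countable structure are all definable at some
countable level. -/
theorem exists_orbitsSigmaDefinable [Countable M] [Nonempty M] :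
    ∃ α < Ordinal.omega 1, OrbitsSigmaDefinable L M α := by
  have sep : ∀ p : Σ n, (Fin n → M) × (Fin n → M), ∃ α < Ordinal.omega 1,
      ∃ φ : InfFormula L p.1, φ.IsSigma α ∧ φ.Realize p.2.1 ∧
        (φ.Realize p.2.2 → p.2.2 ∈ autOrbit L p.2.1) := by
    rintro ⟨n, a, b⟩
    by_cases h : SigmaIncl L a b
    -- Here `b` is already in the orbit, so nothing needs separating.
    · refine ⟨0, Ordinal.omega_pos 1, .qf ⊤ BoundedFormula.IsQF.top, .qf _ _, ?_,
        fun _ => h.mem_autOrbit⟩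
      exact BoundedFormula.realize_top.2 trivial
    · unfold SigmaIncl at h
      push Not at h
      obtain ⟨α, hα, φ, hφ, ha, hb⟩ := h
      exact ⟨α, hα, φ, hφ, ha, fun h => absurd h hb⟩
  choose α hα φ hφ hreal horb using sep
  -- One bound serves tuples of all lengths, as there are countably many pairs.
  obtain ⟨γ, hγ, hαγ⟩ := exists_bound_lt_omega_one α hα
  refine ⟨γ + 1, add_one_lt_omega_one hγ, fun n a => ?_⟩
  obtain ⟨e, he⟩ := exists_surjective_nat (Fin n → M)
  have hpi : (InfFormula.conj fun i => .alls 0 (φ ⟨n, a, e i⟩) : InfFormula L n).IsPi γ :=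
    .conj γ (fun _ => 0) (fun i => φ ⟨n, a, e i⟩) (fun i => α ⟨n, a, e i⟩) (fun i => hαγ _)
      (fun i => hφ _)
  refine ⟨_, isSigma_disj_exs (k := 0) (lt_add_one γ) hpi, fun b => ?_⟩
  rw [realize_disj_exs_zero, realize_conj_alls_zero]
  constructor
  · intro h
    obtain ⟨i, rfl⟩ := he b
    exact horb ⟨n, a, e i⟩ (h i)
  · exact fun h i => realize_of_mem_autOrbit h (hreal ⟨n, a, e i⟩)

end Scott

/-! ### Passing to isomorphic structures -/

theorem OrbitsSigmaDefinable.of_equiv {L : FirstOrder.Language.{0, 0}} {M N : Type*}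
    [L.Structure M] [L.Structure N] (e : M ≃[L] N) {α : Ordinal.{0}}
    (h : OrbitsSigmaDefinable L M α) : OrbitsSigmaDefinable L N α := by
  intro n a
  obtain ⟨φ, hφ, hdef⟩ := h n (e.symm ∘ a)
  refine ⟨φ, hφ, fun b => ?_⟩
  rw [← realize_comp_equiv e.symm, hdef]
  constructor
  · rintro ⟨σ, hσ⟩
    exact ⟨(e.comp σ).comp e.symm, fun i => by simpa using congrArg e (hσ i)⟩
  · rintro ⟨σ, hσ⟩
    exact ⟨(e.symm.comp σ).comp e, fun i => by simpa using hσ i⟩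

end ScottArith

theorem mainTheorem4 (M : Type*) [arith.Structure M] [Countable M]
    (hTA : M ⊨ trueArithmetic) (hM : IsNonstandard M) :
    Ordinal.omega0 < scottRank arith M := by
  have : Nonempty M := ⟨ScottArith.zeroA⟩
  obtain ⟨α, hα, hdef⟩ := ScottArith.exists_orbitsSigmaDefinable arith M
  -- The set is nonempty, so the rank is attained rather than the default `0`.
  have hmem := csInf_mem (s := {α | α < Ordinal.omega 1 ∧ OrbitsSigmaDefinable arith M α})
    ⟨α, hα, hdef⟩
  by_contra hle
  -- `Dfn` quantifies over structures in `Type`, so `M` is replaced by an isomorphic copy there.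
  let f : M ≃ Shrink.{0} M := equivShrink.{0} M
  let _ : arith.Structure (Shrink.{0} M) := f.inducedStructure
  let e : M ≃[arith] Shrink.{0} M := f.inducedStructureEquiv
  exact ScottArith.not_orbitsSigmaDefinable (FirstOrder.Language.StrongHomClass.theory_model e)
    ⟨fun g => hM.false (g.comp e)⟩ (not_lt.1 hle)
    (ScottArith.OrbitsSigmaDefinable.of_equiv e hmem.2)
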